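/- Let $H^{1/2}(\mathbb R)$ be the space of real $u\in L^2(\mathbb R)$ with $[u]^2:=\int_{\mathbb R^2}\frac{(u(x)-u(y))^2}{|x-y|^2}\,dx\,dy<\infty$, let $X=\{u\in H^{1/2}(\mathbb R): u=0 \text{ a.e. in } \mathbb R\setminus(0,1)\}$ and $\|u\|_X=[u]$ for $u\in X$. For $u\in H^{1/2}(\mathbb R)$ let $(-\Delta)^{1/4}u\in L^2(\mathbb R)$ be the function whose $L^2$-Fourier transform is $(2\pi|\xi|)^{1/2}\,\hat u(\xi)$, where $\hat u(\xi)=\int_{\mathbb R} e^{-2\pi i x\xi}u(x)\,dx$ (extended to $L^2$ by continuity). Call $\omega\in(0,\pi]$ admissible if for every $0<\alpha<\omega$ there is $H_\alpha>0$ such that $$\int_{\mathbb R}\big(e^{\alpha u^2}-1\big)\,dx\le H_\alpha\|u\|_{L^2(\mathbb R)}^2\quad\text{for all } u\in H^{1/2}(\mathbb R) \text{ with } \|(-\Delta)^{1/4}u\|_{L^2(\mathbb R)}\le 1 .$$ Then there is a largest admissible $\omega\in(0,\pi]$, and for this $\omega$ the following holds: for every $0<\alpha<2\pi\omega$ there exists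 $K_\alpha>0$ such that $$\int_0^1 e^{\alpha u^2}\,dx\le K_\alpha\quad\text{for all } u\in X \text{ with } \|u\|_X\le 1 .$$ (In particular the last conclusion holds for every admissible $\omega$. The integrals are claimed to be finite.) -/

import Mathlib

open Real Set MeasureTheory
open scoped ENNReal FourierTransform

noncomputable section

/-- The Gagliardo energy `∫∫ (u x - u y)² / |x - y|² dx dy` of order `1/2` on `ℝ`,
as a value in `[0, ∞]`. -/
def gagliardoEnergy (u : ℝ → ℝ) : ℝ≥0∞ :=
  ∫⁻ p : ℝ × ℝ, ENNReal.ofReal ((u p.1 - u p.2) ^ 2 / |p.1 - p.2| ^ 2)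

/-- `u ∈ H^{1/2}(ℝ)`: `u` is square integrable and has finite Gagliardo energy. -/
def MemHHalf (u : ℝ → ℝ) : Prop :=
  MemLp u 2 volume ∧ gagliardoEnergy u < ∞

/-- The Gagliardo seminorm `[u]_{H^{1/2}(ℝ)}` (meaningful when the energy is finite). -/
def gagliardoSeminorm (u : ℝ → ℝ) : ℝ :=
  Real.sqrt (gagliardoEnergy u).toReal

/-- `u ∈ X`: `u ∈ H^{1/2}(ℝ)` and `u = 0` almost everywhere outside `(0, 1)`.
The norm on `X` is `gagliardoSeminorm`. -/
def MemX (u : ℝ → ℝ) : Prop :=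
  MemHHalf u ∧ ∀ᵐ x : ℝ, x ∉ Ioo (0 : ℝ) 1 → u x = 0

/-- `g ∈ L²(ℝ)` is the fractional Laplacian `(-Δ)^s u` of the real function `u ∈ L²(ℝ)`.
In Mathlib's normalization `𝓕 u ξ = ∫ exp (-2 π i x ξ) u x dx`, the operator `-Δ` has the symbol
`(2 π |ξ|)²`, hence `(-Δ)^s` has the symbol `(2 π |ξ|)^{2 s}`. Here `𝓕` is the (Plancherel)
Fourier transform on `L²`, so `g` is uniquely determined by `u`, and it exists exactly when
`(2 π |ξ|)^{2 s} 𝓕 u` lies in `L²`. -/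
def IsFractionalLaplacian (s : ℝ) (u : ℝ → ℝ) (g : Lp ℂ 2 (volume : Measure ℝ)) : Prop :=
  ∃ hu : MemLp (fun x => (u x : ℂ)) 2 volume,
    (𝓕 g : Lp ℂ 2 (volume : Measure ℝ)) =ᵐ[volume]
      fun ξ => (((2 * π * |ξ|) ^ (2 * s) : ℝ) : ℂ) * (𝓕 hu.toLp : Lp ℂ 2 (volume : Measure ℝ)) ξ

/-- The constants `ω ∈ (0, π]` admissible in the fractional Trudinger-Moser inequality on `ℝ`:
for all `0 < α < ω` there is `H > 0` with `∫_ℝ (exp (α u²) - 1) dx ≤ H ‖u‖²_{L²(ℝ)}`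
for every `u ∈ H^{1/2}(ℝ)` with `‖(-Δ)^{1/4} u‖_{L²(ℝ)} ≤ 1`. -/
def ozawaConstants : Set ℝ :=
  {ω | 0 < ω ∧ ω ≤ π ∧ ∀ α : ℝ, 0 < α → α < ω → ∃ H : ℝ, 0 < H ∧
    ∀ u : ℝ → ℝ, MemHHalf u →
      ∀ g : Lp ℂ 2 (volume : Measure ℝ), IsFractionalLaplacian (1 / 4) u g → ‖g‖ ≤ 1 →
        Integrable (fun x => Real.exp (α * u x ^ 2) - 1) ∧
        ∫ x, (Real.exp (α * u x ^ 2) - 1) ≤ H * (eLpNorm u 2 volume).toReal ^ 2}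

end

/-! Two independent facts combine. First, a largest admissible constant exists. Admissibility of `ω`
only concerns exponents strictly below `ω`, so the supremum of the admissible set belongs to it as
soon as the set is nonempty. A crude constant, `π / 64`, shows that it is: `measure_le_norm_le_exp`
cuts `u` at a frequency `R`, bounds the low part uniformly by `t / 2` and the high part in `L²`, and
so gives Gaussian decay of the distribution function; summing over layers of `|u|` gives the
exponential integral, linearly in `‖u‖²`.

Second, any admissible `ω` transfers to `X`. By Plancherel and `∫ (1 - cos t) / t² = π`, the
Gagliardo energy is `2π` times `‖(-Δ)^{1/4} u‖²` (`gagliardoEnergy_eq_lintegral_fourier`). Hence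
`[u] ≤ 1` makes `√(2π) u` a competitor in the inequality on the line, which turns exponents below
`ω` into exponents below `2πω`. A Poincaré inequality on `X` bounds the `L²` norm on the right-hand
side. -/

/-! ### The `L²` Fourier transform and the Fourier integral -/

/-- Both sides define the same tempered distribution: against a test function, the transform moves
onto the test function by the self-adjointness of the Fourier integral. -/
theorem fourier_toLp_ae_eq {f : ℝ → ℂ} (hf : Integrable f) (hf2 : MemLp f 2 volume) :
    (𝓕 hf2.toLp : Lp ℂ 2 (volume : Measure ℝ)) =ᵐ[volume] 𝓕 f := by
  have hcont : Continuous (𝓕 f) :=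
    VectorFourier.fourierIntegral_continuous Real.continuous_fourierChar
      (by exact continuous_inner) hf
  refine ae_eq_of_integral_contDiff_smul_eq
    ((Lp.memLp _).locallyIntegrable (by norm_num)) hcont.locallyIntegrable fun φ hφ hφc ↦ ?_
  have hφc' : HasCompactSupport (Complex.ofRealCLM ∘ φ) := hφc.comp_left rfl
  have hφ' : ContDiff ℝ (↑(⊤ : ℕ∞)) (Complex.ofRealCLM ∘ φ) := by fun_prop
  let ψ : SchwartzMap ℝ ℂ := hφc'.toSchwartzMap hφ'
  have hψ : ∀ x, ψ x = (φ x : ℂ) := fun x ↦ by simp [ψ]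
  have key := DFunLike.congr_fun (Lp.fourier_toTemperedDistribution_eq hf2.toLp) ψ
  rw [TemperedDistribution.fourier_apply, Lp.toTemperedDistribution_apply,
    Lp.toTemperedDistribution_apply] at key
  have h1 : ∫ x, (𝓕 ψ) x • (hf2.toLp : Lp ℂ 2 (volume : Measure ℝ)) x
      = ∫ x, (𝓕 ψ) x • f x := by
    apply integral_congr_ae
    filter_upwards [hf2.coeFn_toLp] with x hx
    rw [hx]
  have h2 : ∫ x, (𝓕 ψ) x • f x = ∫ x, ψ x • 𝓕 f x := by
    have := VectorFourier.integral_fourierIntegral_smul_eq_flip (μ := volume) (ν := volume)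
      (L := innerₗ ℝ) Real.continuous_fourierChar (by exact continuous_inner)
      (ψ.integrable (μ := volume)) hf
    rw [SchwartzMap.fourier_coe]
    rw [flip_innerₗ] at this
    exact this
  rw [h1, h2] at key
  simpa [hψ] using key.symm

theorem fourierInv_toLp_ae_eq {f : ℝ → ℂ} (hf : Integrable f) (hf2 : MemLp f 2 volume) :
    (𝓕⁻ hf2.toLp : Lp ℂ 2 (volume : Measure ℝ)) =ᵐ[volume] 𝓕⁻ f := by
  have hcont : Continuous (𝓕⁻ f) := by
    rw [fourierInv_eq_fourier_comp_neg]
    exact VectorFourier.fourierIntegral_continuous Real.continuous_fourierChar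
      (by exact continuous_inner) hf.comp_neg
  refine ae_eq_of_integral_contDiff_smul_eq
    ((Lp.memLp _).locallyIntegrable (by norm_num)) hcont.locallyIntegrable fun φ hφ hφc ↦ ?_
  have hφc' : HasCompactSupport (Complex.ofRealCLM ∘ φ) := hφc.comp_left rfl
  have hφ' : ContDiff ℝ (↑(⊤ : ℕ∞)) (Complex.ofRealCLM ∘ φ) := by fun_prop
  let ψ : SchwartzMap ℝ ℂ := hφc'.toSchwartzMap hφ'
  have hψ : ∀ x, ψ x = (φ x : ℂ) := fun x ↦ by simp [ψ]
  have key := DFunLike.congr_fun (Lp.fourierInv_toTemperedDistribution_eq hf2.toLp) ψ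
  rw [TemperedDistribution.fourierInv_apply, Lp.toTemperedDistribution_apply,
    Lp.toTemperedDistribution_apply] at key
  have h1 : ∫ x, (𝓕⁻ ψ) x • (hf2.toLp : Lp ℂ 2 (volume : Measure ℝ)) x
      = ∫ x, (𝓕⁻ ψ) x • f x := by
    apply integral_congr_ae
    filter_upwards [hf2.coeFn_toLp] with x hx
    rw [hx]
  have h2 : ∫ x, (𝓕⁻ ψ) x • f x = ∫ x, ψ x • 𝓕⁻ f x := by
    have := VectorFourier.integral_fourierIntegral_smul_eq_flip (μ := volume) (ν := volume)
      -- The inverse transform is the Fourier integral for the negated pairing, so the same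
      -- adjointness applies.
      (L := -innerₗ ℝ) Real.continuous_fourierChar (by exact continuous_inner.neg)
      (ψ.integrable (μ := volume)) hf
    have hfl : (-innerₗ ℝ : ℝ →ₗ[ℝ] ℝ →ₗ[ℝ] ℝ).flip = -innerₗ ℝ := by
      ext; simp
    rw [SchwartzMap.fourierInv_coe]
    rw [hfl] at this
    exact this
  rw [h1, h2] at key
  simpa [hψ] using key.symm

/-- The square of the `L²` norm as a lower Lebesgue integral. -/
theorem enorm_sq_eq_lintegral (f : Lp ℂ 2 (volume : Measure ℝ)) :
    ‖f‖ₑ ^ 2 = ∫⁻ x, ‖f x‖ₑ ^ 2 := by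
  have := eLpNorm_nnreal_pow_eq_lintegral (f := f) (μ := volume) (p := 2) (by norm_num)
  rw [Lp.enorm_def]
  simpa [-ENNReal.rpow_ofNat, ← ENNReal.rpow_two] using this

theorem lintegral_fourier_sq {f : ℝ → ℂ} (hf2 : MemLp f 2 volume) :
    ∫⁻ ξ, ‖(𝓕 hf2.toLp : Lp ℂ 2 (volume : Measure ℝ)) ξ‖ₑ ^ 2 = ∫⁻ x, ‖f x‖ₑ ^ 2 := by
  rw [← enorm_sq_eq_lintegral, ← ofReal_norm, Lp.norm_fourier_eq, ofReal_norm,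
    enorm_sq_eq_lintegral]
  apply lintegral_congr_ae
  filter_upwards [hf2.coeFn_toLp] with x hx
  rw [hx]

/-! ### Gaussian decay of the distribution function by frequency splitting -/

/-- The growth in `R` is only logarithmic; this is what permits a cut-off frequency exponential in
`t²`. -/
theorem integral_inv_add_mul_abs {A R b : ℝ} (hA : 0 < A) (hR : 0 ≤ R) (hb : 0 < b) :
    ∫ ξ in (-R)..R, (A + b * |ξ|)⁻¹ = 2 / b * log ((A + b * R) / A) := by
  have hcont : Continuous fun ξ : ℝ ↦ (A + b * |ξ|)⁻¹ :=
    Continuous.inv₀ (by fun_prop) fun x ↦ by positivity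
  have hpos : ∫ ξ in (0 : ℝ)..R, (A + b * |ξ|)⁻¹ = 1 / b * log ((A + b * R) / A) := by
    have h1 : ∀ ξ ∈ uIcc 0 R, HasDerivAt (fun y ↦ 1 / b * log (A + b * y)) (A + b * |ξ|)⁻¹ ξ := by
      intro ξ hξ
      rw [uIcc_of_le hR] at hξ
      have h0 : A + b * ξ ≠ 0 := by have := hξ.1; positivity
      have h2 : HasDerivAt (fun y ↦ A + b * y) b ξ := by
        simpa using ((hasDerivAt_id ξ).const_mul b).const_add A
      refine ((h2.log h0).const_mul (1 / b)).congr_deriv ?_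
      rw [abs_of_nonneg hξ.1]
      field_simp
    rw [intervalIntegral.integral_eq_sub_of_hasDerivAt h1 (hcont.intervalIntegrable _ _),
      log_div (by positivity) hA.ne']
    simp only [mul_zero, add_zero]
    ring
  have hneg : ∫ ξ in (-R)..0, (A + b * |ξ|)⁻¹ = ∫ ξ in (0 : ℝ)..R, (A + b * |ξ|)⁻¹ := by
    have := intervalIntegral.integral_comp_neg (a := 0) (b := R)
      (fun ξ : ℝ ↦ (A + b * |ξ|)⁻¹)
    simpa using this.symm
  rw [← intervalIntegral.integral_add_adjacent_intervals (b := 0)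
    (hcont.intervalIntegrable _ _) (hcont.intervalIntegrable _ _), hneg, hpos]
  ring

theorem lintegral_inv_add_mul_abs {A R b : ℝ} (hA : 0 < A) (hR : 0 ≤ R) (hb : 0 < b) :
    ∫⁻ ξ in Icc (-R) R, ENNReal.ofReal (A + b * |ξ|)⁻¹
      = ENNReal.ofReal (2 / b * log ((A + b * R) / A)) := by
  have hcont : Continuous fun ξ : ℝ ↦ (A + b * |ξ|)⁻¹ :=
    Continuous.inv₀ (by fun_prop) fun x ↦ by positivity
  rw [← integral_inv_add_mul_abs hA hR hb, intervalIntegral.integral_of_le (by linarith),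
    ← integral_Icc_eq_integral_Ioc, ofReal_integral_eq_lintegral_ofReal
      (hcont.integrableOn_Icc) (ae_of_all _ fun x ↦ by positivity)]

/-- Weighted AM-GM: the difference of the two sides is a perfect square. It replaces Cauchy-Schwarz,
with `s` left free to balance the two terms. -/
theorem enorm_le_ofReal_inv_add {s w : ℝ} (hs : 0 < s) (hw : 0 < w) (z : ℂ) :
    ‖z‖ₑ ≤ ENNReal.ofReal s * ENNReal.ofReal w⁻¹
      + ENNReal.ofReal (4 * s)⁻¹ * (ENNReal.ofReal w * ‖z‖ₑ ^ 2) := by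
  rw [← ofReal_norm, ← ENNReal.ofReal_pow (norm_nonneg _), ← ENNReal.ofReal_mul hw.le,
    ← ENNReal.ofReal_mul hs.le, ← ENNReal.ofReal_mul (by positivity),
    ← ENNReal.ofReal_add (by positivity) (by positivity)]
  apply ENNReal.ofReal_le_ofReal
  have h : s * w⁻¹ + (4 * s)⁻¹ * (w * ‖z‖ ^ 2) - ‖z‖ = (2 * s - w * ‖z‖) ^ 2 / (4 * s * w) := by
    field_simp
    ring
  have : 0 ≤ (2 * s - w * ‖z‖) ^ 2 / (4 * s * w) := by positivity
  linarith

/-- Exponential decay of the distribution function of a function of fractional energy at most one,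
obtained by splitting the function into its low and high frequencies. -/
theorem measure_le_norm_le_exp {f : ℝ → ℂ} (hf : MemLp f 2 volume) {N : ℝ} (hN : 0 < N)
    (hfN : ∫⁻ x, ‖f x‖ₑ ^ 2 = ENNReal.ofReal N)
    (henergy : ∫⁻ ξ, ENNReal.ofReal (2 * π * |ξ|) *
      ‖(𝓕 hf.toLp : Lp ℂ 2 (volume : Measure ℝ)) ξ‖ₑ ^ 2 ≤ 1) {t : ℝ} (ht : 0 < t) :
    volume {x | t ≤ ‖f x‖} ≤ ENNReal.ofReal (8 / t ^ 2 * N * exp (-(π * t ^ 2 / 8))) := by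
  set F : Lp ℂ 2 (volume : Measure ℝ) := 𝓕 hf.toLp with hF
  -- The shift `N⁻¹` normalizes the `L²` part, so the total weighted energy is at most `2` whatever
  -- `N` is.
  set w : ℝ → ℝ := fun ξ ↦ N⁻¹ + 2 * π * |ξ| with hw
  have hwpos : ∀ ξ, 0 < w ξ := fun ξ ↦ by positivity
  have hwm : Measurable w := by fun_prop
  have hFm : AEMeasurable (fun ξ ↦ ‖F ξ‖ₑ ^ 2) volume :=
    ((Lp.memLp F).1.enorm).pow_const 2
  -- Chosen so that the weight at `R` is `N⁻¹ * exp (π t² / 8)`; the integral of `1 / w` over `[-R,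
  -- R]` is then exactly `t² / 8`.
  set R : ℝ := N⁻¹ * (exp (π * t ^ 2 / 8) - 1) / (2 * π) with hR
  have hRnn : 0 ≤ R := by
    have : 1 ≤ exp (π * t ^ 2 / 8) := one_le_exp (by positivity)
    have : 0 ≤ exp (π * t ^ 2 / 8) - 1 := by linarith
    positivity
  have hwR : N⁻¹ + 2 * π * R = N⁻¹ * exp (π * t ^ 2 / 8) := by
    rw [hR]; field_simp; ring
  -- weighted energy
  have hweight : ∫⁻ ξ, ENNReal.ofReal (w ξ) * ‖F ξ‖ₑ ^ 2 ≤ 2 := by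
    calc ∫⁻ ξ, ENNReal.ofReal (w ξ) * ‖F ξ‖ₑ ^ 2
        = ∫⁻ ξ, (ENNReal.ofReal N⁻¹ * ‖F ξ‖ₑ ^ 2
            + ENNReal.ofReal (2 * π * |ξ|) * ‖F ξ‖ₑ ^ 2) := by
          refine lintegral_congr fun ξ ↦ ?_
          rw [hw, ENNReal.ofReal_add (by positivity) (by positivity), add_mul]
      _ = ENNReal.ofReal N⁻¹ * (∫⁻ ξ, ‖F ξ‖ₑ ^ 2)
            + ∫⁻ ξ, ENNReal.ofReal (2 * π * |ξ|) * ‖F ξ‖ₑ ^ 2 := by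
          rw [lintegral_add_left' (hFm.const_mul _), lintegral_const_mul'' _ hFm]
      _ ≤ 1 + 1 := by
          gcongr
          rw [hF, lintegral_fourier_sq hf, hfN, ← ENNReal.ofReal_mul (by positivity),
            inv_mul_cancel₀ hN.ne', ENNReal.ofReal_one]
      _ = 2 := by norm_num
  -- low frequencies
  have hlow : ∫⁻ ξ in Icc (-R) R, ‖F ξ‖ₑ ≤ ENNReal.ofReal (t / 2) := by
    -- With `s = 2 / t` each of the two terms contributes at most `t / 4`.
    calc ∫⁻ ξ in Icc (-R) R, ‖F ξ‖ₑ
        ≤ ∫⁻ ξ in Icc (-R) R, (ENNReal.ofReal (2 / t) * ENNReal.ofReal (w ξ)⁻¹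
          + ENNReal.ofReal (4 * (2 / t))⁻¹ * (ENNReal.ofReal (w ξ) * ‖F ξ‖ₑ ^ 2)) :=
          lintegral_mono fun ξ ↦ enorm_le_ofReal_inv_add (by positivity) (hwpos ξ) _
      _ = ENNReal.ofReal (2 / t) * (∫⁻ ξ in Icc (-R) R, ENNReal.ofReal (w ξ)⁻¹)
          + ENNReal.ofReal (4 * (2 / t))⁻¹ *
            ∫⁻ ξ in Icc (-R) R, ENNReal.ofReal (w ξ) * ‖F ξ‖ₑ ^ 2 := by
          rw [lintegral_add_left (by fun_prop), lintegral_const_mul _ (by fun_prop),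
            lintegral_const_mul'' _ (by fun_prop)]
      _ ≤ ENNReal.ofReal (2 / t) * ENNReal.ofReal (t ^ 2 / 8)
          + ENNReal.ofReal (4 * (2 / t))⁻¹ * ENNReal.ofReal 2 := by
          gcongr
          · rw [hw, lintegral_inv_add_mul_abs (by positivity) hRnn (by positivity), hwR]
            apply le_of_eq
            congr 1
            rw [mul_div_cancel_left₀ _ (by positivity), log_exp]
            field_simp
          · calc _ ≤ ∫⁻ ξ, ENNReal.ofReal (w ξ) * ‖F ξ‖ₑ ^ 2 := setLIntegral_le_lintegral _ _
              _ ≤ _ := by simpa using hweight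
      _ = ENNReal.ofReal (t / 2) := by
          rw [← ENNReal.ofReal_mul (by positivity), ← ENNReal.ofReal_mul (by positivity),
            ← ENNReal.ofReal_add (by positivity) (by positivity)]
          congr 1
          field_simp
          norm_num
  set L : ℝ → ℂ := (Icc (-R) R).indicator F with hL
  have hL2 : MemLp L 2 volume := (Lp.memLp F).indicator measurableSet_Icc
  have hLenorm : ∀ ξ, ‖L ξ‖ₑ = (Icc (-R) R).indicator (fun ξ ↦ ‖F ξ‖ₑ) ξ := fun ξ ↦ by
    rw [hL, enorm_indicator_eq_indicator_enorm]
  have hLlow : ∫⁻ ξ, ‖L ξ‖ₑ ≤ ENNReal.ofReal (t / 2) := by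
    simp_rw [hLenorm]
    rwa [lintegral_indicator measurableSet_Icc]
  have hL1 : Integrable L := ⟨hL2.1, lt_of_le_of_lt hLlow ENNReal.ofReal_lt_top⟩
  have hsup : ∀ x, ‖𝓕⁻ L x‖ ≤ t / 2 := fun x ↦ by
    refine (VectorFourier.norm_fourierIntegral_le_integral_norm _ _ _ _ _).trans ?_
    rw [integral_norm_eq_lintegral_enorm hL1.1]
    exact ENNReal.toReal_le_of_le_ofReal (by positivity) hLlow
  -- high frequencies
  set d : Lp ℂ 2 (volume : Measure ℝ) := hf.toLp - 𝓕⁻ hL2.toLp with hd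
  have hFd : 𝓕 d = F - hL2.toLp := by
    rw [hd, sub_eq_add_neg, ← neg_one_smul ℂ, FourierTransform.fourier_add,
      FourierTransform.fourier_smul, FourierTransform.fourier_fourierInv_eq, neg_one_smul,
      ← sub_eq_add_neg]
  have hhigh : ∫⁻ x, ‖d x‖ₑ ^ 2 ≤ ENNReal.ofReal (2 * N * exp (-(π * t ^ 2 / 8))) := by
    have hwinv : (N⁻¹ + 2 * π * R)⁻¹ = N * exp (-(π * t ^ 2 / 8)) := by
      rw [hwR, exp_neg, mul_inv, inv_inv]
    calc ∫⁻ x, ‖d x‖ₑ ^ 2 = ∫⁻ ξ, ‖(𝓕 d : Lp ℂ 2 (volume : Measure ℝ)) ξ‖ₑ ^ 2 := by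
          rw [← enorm_sq_eq_lintegral, ← enorm_sq_eq_lintegral, ← ofReal_norm, ← ofReal_norm,
            Lp.norm_fourier_eq]
      -- `𝓕 d` vanishes for `|ξ| ≤ R`, and beyond `R` the weight is at least its value at `R`.
      _ ≤ ∫⁻ ξ, ENNReal.ofReal (N⁻¹ + 2 * π * R)⁻¹ * (ENNReal.ofReal (w ξ) * ‖F ξ‖ₑ ^ 2) := by
          apply lintegral_mono_ae
          rw [hFd]
          filter_upwards [Lp.coeFn_sub F hL2.toLp, hL2.coeFn_toLp] with ξ h1 h2
          rw [h1, Pi.sub_apply, h2, hL]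
          by_cases hξ : ξ ∈ Icc (-R) R
          · simp [indicator_of_mem hξ]
          · rw [indicator_of_notMem hξ, sub_zero, ← mul_assoc,
              ← ENNReal.ofReal_mul (by positivity)]
            refine le_mul_of_one_le_left (by positivity) ?_
            rw [ENNReal.one_le_ofReal, inv_mul_eq_div, one_le_div (by positivity), hw]
            have : R ≤ |ξ| := by
              rw [mem_Icc, ← abs_le, not_le] at hξ
              exact hξ.le
            change N⁻¹ + 2 * π * R ≤ N⁻¹ + 2 * π * |ξ|
            gcongr
      _ ≤ ENNReal.ofReal (N⁻¹ + 2 * π * R)⁻¹ * ENNReal.ofReal 2 := by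
          rw [lintegral_const_mul'' _ (by fun_prop)]
          gcongr
          simpa using hweight
      _ = _ := by
          rw [← ENNReal.ofReal_mul (by positivity), hwinv]
          congr 1
          ring
  -- The low-frequency part is at most `t / 2` everywhere, so `|f| ≥ t` forces `|d| ≥ t / 2`, and
  -- Chebyshev applies to `d`.
  have hsub : {x | t ≤ ‖f x‖} ≤ᵐ[volume] {x | ENNReal.ofReal (t ^ 2 / 4) ≤ ‖d x‖ₑ ^ 2} := by
    filter_upwards [Lp.coeFn_sub hf.toLp (𝓕⁻ hL2.toLp), hf.coeFn_toLp,
      fourierInv_toLp_ae_eq hL1 hL2] with x h1 h2 h3 hx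
    have hx' : t ≤ ‖f x‖ := hx
    change ENNReal.ofReal (t ^ 2 / 4) ≤ ‖d x‖ₑ ^ 2
    rw [hd, h1, Pi.sub_apply, h2, h3, ← ofReal_norm, ← ENNReal.ofReal_pow (norm_nonneg _)]
    apply ENNReal.ofReal_le_ofReal
    have h4 : t / 2 ≤ ‖f x - 𝓕⁻ L x‖ := by
      have := norm_sub_norm_le (f x) (𝓕⁻ L x)
      have := hsup x
      linarith
    calc t ^ 2 / 4 = (t / 2) ^ 2 := by ring
      _ ≤ _ := by gcongr
  have hcheb := mul_meas_ge_le_lintegral₀ (μ := volume) (f := fun x ↦ ‖d x‖ₑ ^ 2)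
    (((Lp.memLp d).1.enorm).pow_const 2) (ENNReal.ofReal (t ^ 2 / 4))
  calc volume {x | t ≤ ‖f x‖} ≤ volume {x | ENNReal.ofReal (t ^ 2 / 4) ≤ ‖d x‖ₑ ^ 2} :=
        measure_mono_ae hsub
    _ ≤ ENNReal.ofReal (t ^ 2 / 4)⁻¹ * ENNReal.ofReal (2 * N * exp (-(π * t ^ 2 / 8))) := by
        rw [ENNReal.ofReal_inv_of_pos (by positivity), mul_comm, ← div_eq_mul_inv,
          ENNReal.le_div_iff_mul_le (Or.inl (by simp; positivity)) (Or.inl (by simp)), mul_comm]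
        exact hcheb.trans hhigh
    _ = _ := by
        rw [← ENNReal.ofReal_mul (by positivity)]
        congr 1
        field_simp
        norm_num

/-! ### Exponential integrability and the largest admissible constant -/

/-- For `|u| < 1` use `eˣ - 1 ≤ x eˣ`. Otherwise the single layer `k = ⌊|u|⌋ - 1`, where `k + 1 ≤
|u| ≤ k + 2`, already suffices. The indicators integrate to values of the distribution function. -/
theorem exp_mul_sq_sub_one_le_tsum {α : ℝ} (hα : 0 < α) (u : ℝ) :
    ENNReal.ofReal (exp (α * u ^ 2) - 1) ≤ ENNReal.ofReal (α * exp α) * ‖u‖ₑ ^ 2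
      + ∑' k : ℕ, ENNReal.ofReal (exp (α * (k + 2) ^ 2)) *
        {v : ℝ | (k : ℝ) + 1 ≤ |v|}.indicator 1 u := by
  rcases lt_or_ge |u| 1 with h | h
  · refine le_trans ?_ le_self_add
    rw [← ofReal_norm, ← ENNReal.ofReal_pow (norm_nonneg _), ← ENNReal.ofReal_mul (by positivity)]
    apply ENNReal.ofReal_le_ofReal
    have h1 : u ^ 2 ≤ 1 := (sq_le_one_iff_abs_le_one u).2 h.le
    have h2 : 1 - α * u ^ 2 ≤ exp (-(α * u ^ 2)) := by
      have := add_one_le_exp (-(α * u ^ 2)); linarith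
    have h3 : exp (α * u ^ 2) * exp (-(α * u ^ 2)) = 1 := by rw [← exp_add]; simp
    have h4 : exp (α * u ^ 2) ≤ exp α := exp_le_exp.2 (by nlinarith)
    have h5 : exp (α * u ^ 2) - 1 ≤ α * u ^ 2 * exp (α * u ^ 2) := by
      nlinarith [exp_pos (α * u ^ 2)]
    rw [norm_eq_abs, sq_abs]
    calc _ ≤ α * u ^ 2 * exp (α * u ^ 2) := h5
      _ ≤ α * u ^ 2 * exp α := by gcongr
      _ = _ := by ring
  · refine le_trans ?_ le_add_self
    have h0 : 1 ≤ ⌊|u|⌋₊ := (Nat.one_le_floor_iff _).2 h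
    obtain ⟨k, hk⟩ := Nat.exists_eq_add_of_le' h0
    have h1 : (k : ℝ) + 1 ≤ |u| := by
      have := Nat.floor_le (abs_nonneg u)
      rw [hk] at this
      exact_mod_cast this
    have h2 : |u| ≤ k + 2 := by
      have := (Nat.lt_floor_add_one |u|).le
      rw [hk] at this
      push_cast at this
      linarith
    refine le_trans ?_ (ENNReal.le_tsum k)
    rw [indicator_of_mem (by exact h1), Pi.one_apply, mul_one]
    apply ENNReal.ofReal_le_ofReal
    have h3 : exp (α * u ^ 2) ≤ exp (α * (k + 2) ^ 2) := by
      rw [← sq_abs u]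
      gcongr
    linarith

theorem summable_exp_neg_mul_succ {c : ℝ} (hc : 0 < c) :
    Summable fun k : ℕ ↦ exp (-(c * (k + 1))) := by
  have h := (Real.summable_exp_nat_mul_iff (a := -c)).2 (by linarith)
  refine (h.mul_left (exp (-c))).congr fun k ↦ ?_
  rw [← exp_add]
  congr 1
  ring

/-- The threshold `π / 64` comes from `(k + 2)² ≤ 4 (k + 1)²`: the growth `α (k + 2)²` uses at most
half of the decay `π (k + 1)² / 8`, and the other half makes the series converge. -/
theorem lintegral_exp_mul_sq_sub_one_le {u : ℝ → ℝ} (hu : AEMeasurable u volume) {N : ℝ}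
    (hN : 0 ≤ N) (huN : ∫⁻ x, ‖u x‖ₑ ^ 2 ≤ ENNReal.ofReal N)
    (hdist : ∀ t : ℝ, 0 < t →
      volume {x | t ≤ |u x|} ≤ ENNReal.ofReal (8 / t ^ 2 * N * exp (-(π * t ^ 2 / 8))))
    {α : ℝ} (hα : 0 < α) (hα' : α < π / 64) :
    ∫⁻ x, ENNReal.ofReal (exp (α * u x ^ 2) - 1)
      ≤ ENNReal.ofReal ((α * exp α + ∑' k : ℕ, 8 * exp (-(π / 16 * (k + 1)))) * N) := by
  have hsum : Summable fun k : ℕ ↦ 8 * exp (-(π / 16 * (k + 1))) :=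
    (summable_exp_neg_mul_succ (by positivity)).mul_left 8
  have hset : ∀ k : ℕ, MeasurableSet {v : ℝ | (k : ℝ) + 1 ≤ |v|} := fun k ↦
    measurableSet_le measurable_const measurable_norm
  have hterm : ∀ k : ℕ, AEMeasurable (fun x ↦ ENNReal.ofReal (exp (α * (k + 2) ^ 2)) *
      {v : ℝ | (k : ℝ) + 1 ≤ |v|}.indicator (1 : ℝ → ℝ≥0∞) (u x)) volume := fun k ↦
    ((measurable_one.indicator (hset k)).comp_aemeasurable hu).const_mul _
  calc ∫⁻ x, ENNReal.ofReal (exp (α * u x ^ 2) - 1)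
      ≤ ∫⁻ x, (ENNReal.ofReal (α * exp α) * ‖u x‖ₑ ^ 2
          + ∑' k : ℕ, ENNReal.ofReal (exp (α * (k + 2) ^ 2)) *
            {v : ℝ | (k : ℝ) + 1 ≤ |v|}.indicator 1 (u x)) :=
        lintegral_mono fun x ↦ exp_mul_sq_sub_one_le_tsum hα (u x)
    _ = ENNReal.ofReal (α * exp α) * (∫⁻ x, ‖u x‖ₑ ^ 2)
          + ∑' k : ℕ, ENNReal.ofReal (exp (α * (k + 2) ^ 2)) *
            volume {x | (k : ℝ) + 1 ≤ |u x|} := by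
        rw [lintegral_add_left' (by fun_prop), lintegral_const_mul'' _ (by fun_prop),
          lintegral_tsum hterm]
        congr 2
        funext k
        rw [lintegral_const_mul' _ _ ENNReal.ofReal_ne_top]
        congr 1
        have : (fun x ↦ {v : ℝ | (k : ℝ) + 1 ≤ |v|}.indicator (1 : ℝ → ℝ≥0∞) (u x))
            = {x | (k : ℝ) + 1 ≤ |u x|}.indicator 1 := rfl
        rw [this, lintegral_indicator_one₀]
        exact hu.nullMeasurableSet_preimage (hset k)
    _ ≤ ENNReal.ofReal (α * exp α) * ENNReal.ofReal N
          + ∑' k : ℕ, ENNReal.ofReal (8 * exp (-(π / 16 * (k + 1))) * N) := by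
        gcongr with k
        refine (mul_le_mul_right (hdist (k + 1) (by positivity)) _).trans ?_
        rw [← ENNReal.ofReal_mul (by positivity)]
        apply ENNReal.ofReal_le_ofReal
        have hk : (1 : ℝ) ≤ k + 1 := by simp
        have hk2 : (k : ℝ) + 1 ≤ (k + 1) ^ 2 := by nlinarith
        have e1 : exp (α * (k + 2) ^ 2) * exp (-(π * (k + 1) ^ 2 / 8))
            ≤ exp (-(π / 16 * (k + 1))) := by
          rw [← exp_add]
          apply exp_le_exp.2
          have i1 : α * ((k : ℝ) + 2) ^ 2 ≤ π / 64 * (4 * (k + 1) ^ 2) := by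
            gcongr
            nlinarith
          have i2 : π / 16 * ((k : ℝ) + 1) ≤ π / 16 * (k + 1) ^ 2 := by gcongr
          linarith
        have e2 : 8 / ((k : ℝ) + 1) ^ 2 ≤ 8 := div_le_self (by norm_num) (by nlinarith)
        calc exp (α * (k + 2) ^ 2) * (8 / ((k : ℝ) + 1) ^ 2 * N * exp (-(π * (k + 1) ^ 2 / 8)))
            = (8 / ((k : ℝ) + 1) ^ 2) *
              (exp (α * (k + 2) ^ 2) * exp (-(π * (k + 1) ^ 2 / 8))) * N := by ring
          _ ≤ 8 * exp (-(π / 16 * (k + 1))) * N := by gcongr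
    _ = _ := by
        rw [← ENNReal.ofReal_tsum_of_nonneg (fun k ↦ by positivity) (hsum.mul_right N),
          tsum_mul_right, ← ENNReal.ofReal_mul (by positivity), ← ENNReal.ofReal_add
          (by positivity) (mul_nonneg (tsum_nonneg fun k ↦ by positivity) hN), add_mul]

theorem lintegral_enorm_sq_eq_ofReal {u : ℝ → ℝ} (hu : MemLp u 2 volume) :
    ∫⁻ x, ‖u x‖ₑ ^ 2 = ENNReal.ofReal ((eLpNorm u 2 volume).toReal ^ 2) := by
  have h := eLpNorm_nnreal_pow_eq_lintegral (f := u) (μ := volume) (p := 2) (by norm_num)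
  have h' : eLpNorm u 2 volume ^ 2 = ∫⁻ x, ‖u x‖ₑ ^ 2 := by
    simpa [-ENNReal.rpow_ofNat, ← ENNReal.rpow_two] using h
  rw [← h', ENNReal.ofReal_pow ENNReal.toReal_nonneg, ENNReal.ofReal_toReal hu.2.ne]

theorem IsFractionalLaplacian.lintegral_le_one {u : ℝ → ℝ}
    {g : Lp ℂ 2 (volume : Measure ℝ)} (hu : MemLp (fun x ↦ (u x : ℂ)) 2 volume)
    (h : IsFractionalLaplacian (1 / 4) u g) (hg : ‖g‖ ≤ 1) :
    ∫⁻ ξ, ENNReal.ofReal (2 * π * |ξ|) *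
      ‖(𝓕 hu.toLp : Lp ℂ 2 (volume : Measure ℝ)) ξ‖ₑ ^ 2 ≤ 1 := by
  obtain ⟨hu', h⟩ := h
  have hg' : ‖𝓕 g‖ₑ ^ 2 ≤ 1 := by
    rw [← ofReal_norm, Lp.norm_fourier_eq, ← ENNReal.ofReal_pow (norm_nonneg _),
      ENNReal.ofReal_le_one]
    exact pow_le_one₀ (norm_nonneg _) hg
  rw [enorm_sq_eq_lintegral] at hg'
  refine le_trans (le_of_eq (lintegral_congr_ae ?_)) hg'
  filter_upwards [h] with ξ hξ
  rw [hξ, enorm_mul, mul_pow]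
  congr 1
  rw [← ofReal_norm, Complex.norm_real, norm_of_nonneg (by positivity),
    ← ENNReal.ofReal_pow (by positivity), ← rpow_mul_natCast (by positivity)]
  norm_num

theorem pi_div_mem_ozawaConstants : π / 64 ∈ ozawaConstants := by
  refine ⟨by positivity, div_le_self pi_pos.le (by norm_num), fun α hα hα' ↦
    ⟨α * exp α + ∑' k : ℕ, 8 * exp (-(π / 16 * (k + 1))), ?_, fun u hu g hg hg1 ↦ ?_⟩⟩
  · exact add_pos_of_pos_of_nonneg (by positivity) (tsum_nonneg fun k ↦ by positivity)
  have hum : AEMeasurable u volume := hu.1.1.aemeasurable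
  have huc : MemLp (fun x ↦ (u x : ℂ)) 2 volume := hu.1.ofReal
  have hN := lintegral_enorm_sq_eq_ofReal hu.1
  set N : ℝ := (eLpNorm u 2 volume).toReal ^ 2 with hNdef
  have hN0 : 0 ≤ N := by positivity
  have hdist : ∀ t : ℝ, 0 < t →
      volume {x | t ≤ |u x|} ≤ ENNReal.ofReal (8 / t ^ 2 * N * exp (-(π * t ^ 2 / 8))) := by
    intro t ht
    -- The weight in the frequency splitting involves `N⁻¹`, so `N = 0`, where `u` vanishes almost
    -- everywhere, is separate.
    rcases hN0.eq_or_lt with h0 | h0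
    · rw [← h0, ENNReal.ofReal_zero, lintegral_eq_zero_iff' (by fun_prop)] at hN
      refine le_of_eq_of_le (measure_mono_null (fun x hx ↦ ?_) (ae_iff.1 hN)) zero_le
      have hx' : t ≤ |u x| := hx
      have : u x ≠ 0 := fun h ↦ by rw [h, abs_zero] at hx'; linarith
      simpa using this
    · have h1 : ∫⁻ x, ‖(u x : ℂ)‖ₑ ^ 2 = ENNReal.ofReal N := by
        rw [← hN]
        refine lintegral_congr fun x ↦ ?_
        rw [← ofReal_norm, ← ofReal_norm, Complex.norm_real]
      simpa using measure_le_norm_le_exp huc h0 h1 (hg.lintegral_le_one huc hg1) ht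
  have hle := lintegral_exp_mul_sq_sub_one_le hum hN0 hN.le hdist hα hα'
  have hnn : ∀ x, 0 ≤ exp (α * u x ^ 2) - 1 := fun x ↦
    sub_nonneg.2 (one_le_exp (by positivity))
  have hmeas : AEStronglyMeasurable (fun x ↦ exp (α * u x ^ 2) - 1) volume :=
    AEMeasurable.aestronglyMeasurable (by fun_prop)
  refine ⟨⟨hmeas, ?_⟩, ?_⟩
  · rw [hasFiniteIntegral_iff_ofReal (ae_of_all _ hnn)]
    exact hle.trans_lt ENNReal.ofReal_lt_top
  · rw [integral_eq_lintegral_of_nonneg_ae (ae_of_all _ hnn) hmeas]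
    refine ENNReal.toReal_le_of_le_ofReal ?_ hle
    exact mul_nonneg (add_nonneg (by positivity) (tsum_nonneg fun k ↦ by positivity)) hN0

/-- The supremum is attained: any `α` below it lies below some admissible constant, which provides
the bound for `α`. -/
theorem exists_isGreatest_ozawaConstants : ∃ ω, IsGreatest ozawaConstants ω := by
  have hbdd : BddAbove ozawaConstants := ⟨π, fun ω h ↦ h.2.1⟩
  have hne : ozawaConstants.Nonempty := ⟨_, pi_div_mem_ozawaConstants⟩
  refine ⟨sSup ozawaConstants, ⟨?_, csSup_le hne fun ω h ↦ h.2.1, fun α hα hα' ↦ ?_⟩,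
    fun ω h ↦ le_csSup hbdd h⟩
  · exact pi_div_mem_ozawaConstants.1.trans_le (le_csSup hbdd pi_div_mem_ozawaConstants)
  · obtain ⟨ω, hω, h⟩ := exists_lt_of_lt_csSup hne hα'
    exact hω.2.2 α hα h

/-! ### The integral of `(1 - cos t) / t²` -/

theorem integrableOn_one_sub_cos_mul_exp {s : ℝ} (hs : 0 < s) :
    IntegrableOn (fun t ↦ (1 - cos t) * exp (-(s * t))) (Ioi 0) := by
  have h : IntegrableOn (fun t ↦ exp (-s * t)) (Ioi 0) := integrableOn_exp_mul_Ioi (by linarith) 0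
  refine (h.const_mul 2).mono' (by fun_prop) (ae_of_all _ fun t ↦ ?_)
  rw [norm_mul, norm_eq_abs, norm_eq_abs, abs_exp, neg_mul,
    abs_of_nonneg (sub_nonneg.2 (cos_le_one t))]
  gcongr
  linarith [neg_one_le_cos t]

theorem integral_one_sub_cos_mul_exp {s : ℝ} (hs : 0 < s) :
    ∫ t in Ioi 0, (1 - cos t) * exp (-(s * t)) = s⁻¹ * (1 + s ^ 2)⁻¹ := by
  have ha : (-(s : ℂ)).re < 0 := by simpa
  have hb : (-(s : ℂ) + Complex.I).re < 0 := by simpa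
  have e : ∀ t : ℝ, (1 - cos t) * exp (-(s * t))
      = RCLike.re (Complex.exp (-(s : ℂ) * t) - Complex.exp ((-(s : ℂ) + Complex.I) * t)) := by
    intro t
    simp [Complex.exp_re]
    ring
  have hia := integrableOn_exp_mul_complex_Ioi ha 0
  have hib := integrableOn_exp_mul_complex_Ioi hb 0
  simp_rw [e]
  refine (integral_re (hia.sub hib)).trans ?_
  simp only [Pi.sub_apply]
  rw [integral_sub hia hib, integral_exp_mul_complex_Ioi ha,
    integral_exp_mul_complex_Ioi hb]
  have h0 : -(s : ℂ) + Complex.I ≠ 0 := fun h ↦ by rw [h] at hb; simp at hb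
  simp [Complex.div_re, Complex.normSq_apply]
  field_simp
  ring

theorem lintegral_mul_exp_neg {t : ℝ} (ht : 0 < t) :
    ∫⁻ s in Ioi 0, ENNReal.ofReal (s * exp (-(s * t))) = ENNReal.ofReal (1 / t ^ 2) := by
  have h := integral_rpow_mul_exp_neg_mul_Ioi (a := 2) (r := t) (by norm_num) ht
  have hg : Gamma 2 = 1 := by simp
  have h2 := integrableOn_rpow_mul_exp_neg_mul_rpow (s := 1) (p := 1) (b := t) (by norm_num)
    (by norm_num) ht
  rw [hg] at h
  norm_num at h h2
  have e : ∀ s : ℝ, s * exp (-(s * t)) = s * exp (-(t * s)) := fun s ↦ by rw [mul_comm s t]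
  simp_rw [e]
  rw [← ofReal_integral_eq_lintegral_ofReal h2, h, one_div]
  filter_upwards [ae_restrict_mem measurableSet_Ioi] with s hs
  have : (0 : ℝ) < s := hs
  positivity

/-- Writing `1 / t²` as the Laplace integral of `s` and exchanging the integrals by Tonelli leaves
`∫ 1 / (1 + s²)` over the half-line. -/
theorem lintegral_Ioi_one_sub_cos_div_sq :
    ∫⁻ t in Ioi 0, ENNReal.ofReal ((1 - cos t) / t ^ 2) = ENNReal.ofReal (π / 2) := by
  calc ∫⁻ t in Ioi 0, ENNReal.ofReal ((1 - cos t) / t ^ 2)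
      = ∫⁻ t in Ioi 0, ∫⁻ s in Ioi 0,
          ENNReal.ofReal (1 - cos t) * ENNReal.ofReal (s * exp (-(s * t))) := by
        refine setLIntegral_congr_fun measurableSet_Ioi fun t ht ↦ ?_
        rw [lintegral_const_mul _ (by fun_prop), lintegral_mul_exp_neg ht,
          ← ENNReal.ofReal_mul (sub_nonneg.2 (cos_le_one t)), mul_one_div]
    _ = ∫⁻ s in Ioi 0, ∫⁻ t in Ioi 0,
          ENNReal.ofReal (1 - cos t) * ENNReal.ofReal (s * exp (-(s * t))) := by
        refine lintegral_lintegral_swap (Measurable.aemeasurable ?_)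
        simp only [Function.uncurry_def]
        fun_prop
    _ = ∫⁻ s in Ioi 0, ENNReal.ofReal ((1 + s ^ 2)⁻¹) := by
        refine setLIntegral_congr_fun measurableSet_Ioi fun s hs ↦ ?_
        have hs' : 0 < s := hs
        have h1 : ∀ t : ℝ, ENNReal.ofReal (1 - cos t) * ENNReal.ofReal (s * exp (-(s * t)))
            = ENNReal.ofReal s * ENNReal.ofReal ((1 - cos t) * exp (-(s * t))) := fun t ↦ by
          rw [← ENNReal.ofReal_mul (sub_nonneg.2 (cos_le_one t)), ← ENNReal.ofReal_mul hs'.le]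
          congr 1
          ring
        simp_rw [h1]
        rw [lintegral_const_mul _ (by fun_prop), ← ofReal_integral_eq_lintegral_ofReal
          (integrableOn_one_sub_cos_mul_exp hs') (ae_of_all _ fun t ↦
            mul_nonneg (sub_nonneg.2 (cos_le_one t)) (exp_pos _).le),
          integral_one_sub_cos_mul_exp hs', ← ENNReal.ofReal_mul hs'.le,
          mul_inv_cancel_left₀ hs'.ne']
    _ = _ := by
        rw [← ofReal_integral_eq_lintegral_ofReal integrable_inv_one_add_sq.integrableOn
          (ae_of_all _ fun t ↦ by positivity), integral_Ioi_inv_one_add_sq]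
        simp

theorem lintegral_one_sub_cos_div_sq :
    ∫⁻ t, ENNReal.ofReal ((1 - cos t) / t ^ 2) = ENNReal.ofReal π := by
  have hneg : ∫⁻ t in Iio 0, ENNReal.ofReal ((1 - cos t) / t ^ 2)
      = ∫⁻ t in Ioi 0, ENNReal.ofReal ((1 - cos t) / t ^ 2) := by
    have := (Measure.measurePreserving_neg (volume : Measure ℝ)).setLIntegral_comp_preimage
      (s := Ioi 0) measurableSet_Ioi (f := fun t ↦ ENNReal.ofReal ((1 - cos t) / t ^ 2))
      (by fun_prop)
    simpa using this
  rw [← lintegral_add_compl _ (measurableSet_Ioi (a := (0 : ℝ))), compl_Ioi,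
    setLIntegral_congr Iio_ae_eq_Iic.symm, hneg, lintegral_Ioi_one_sub_cos_div_sq,
    ← ENNReal.ofReal_add (by positivity) (by positivity)]
  congr 1
  ring

theorem lintegral_comp_mul_left' (f : ℝ → ℝ≥0∞) {a : ℝ} (ha : a ≠ 0) :
    ∫⁻ x, f (a * x) = ENNReal.ofReal |a⁻¹| * ∫⁻ x, f x := by
  have h := (Homeomorph.mulLeft₀ a ha).measurableEmbedding.lintegral_map (μ := volume) f
  rw [Homeomorph.coe_mulLeft₀, Real.map_volume_mul_left ha, lintegral_smul_measure,
    smul_eq_mul] at h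
  exact h.symm

theorem lintegral_two_sub_two_cos_div_sq (ξ : ℝ) :
    ∫⁻ h, ENNReal.ofReal ((2 - 2 * cos (2 * π * ξ * h)) / h ^ 2)
      = ENNReal.ofReal (4 * π ^ 2 * |ξ|) := by
  rcases eq_or_ne ξ 0 with rfl | hξ
  · simp
  have ha : 2 * π * ξ ≠ 0 := by positivity
  have e : ∀ h : ℝ, ENNReal.ofReal ((2 - 2 * cos (2 * π * ξ * h)) / h ^ 2)
      = ENNReal.ofReal (2 * (2 * π * ξ) ^ 2) *
        ENNReal.ofReal ((1 - cos (2 * π * ξ * h)) / (2 * π * ξ * h) ^ 2) := fun h ↦ by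
    rw [← ENNReal.ofReal_mul (by positivity)]
    congr 1
    rcases eq_or_ne h 0 with rfl | hh
    · simp
    field_simp
  simp_rw [e]
  rw [lintegral_const_mul _ (by fun_prop),
    lintegral_comp_mul_left' (fun t ↦ ENNReal.ofReal ((1 - cos t) / t ^ 2)) ha,
    lintegral_one_sub_cos_div_sq, ← ENNReal.ofReal_mul (by positivity),
    ← ENNReal.ofReal_mul (by positivity)]
  congr 1
  rw [abs_inv, abs_mul, abs_of_pos (by positivity : 0 < 2 * π), ← sq_abs (2 * π * ξ), abs_mul,
    abs_of_pos (by positivity : 0 < 2 * π)]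
  have : |ξ| ≠ 0 := by positivity
  field_simp
  ring

/-! ### The Gagliardo energy on the Fourier side -/

/-- Plancherel: translation by `h` multiplies the transform by a phase `exp (iθ)` with `θ = 2πξh`,
and `|1 - exp (iθ)|² = 2 - 2 cos θ`. -/
theorem lintegral_sub_comp_add_sq {u : ℝ → ℂ} (hu1 : Integrable u) (hu2 : MemLp u 2 volume)
    (h : ℝ) :
    ∫⁻ x, ‖u x - u (x + h)‖ₑ ^ 2
      = ∫⁻ ξ, ENNReal.ofReal (2 - 2 * cos (2 * π * ξ * h)) * ‖𝓕 u ξ‖ₑ ^ 2 := by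
  have hmp := measurePreserving_add_right (volume : Measure ℝ) h
  have hs2 : MemLp (fun x ↦ u (x + h)) 2 volume := hu2.comp_measurePreserving hmp
  have hs1 : Integrable fun x ↦ u (x + h) := hu1.comp_add_right h
  have hv1 : Integrable fun x ↦ u x - u (x + h) := hu1.sub hs1
  have hv2 : MemLp (fun x ↦ u x - u (x + h)) 2 volume := hu2.sub hs2
  rw [← lintegral_fourier_sq hv2]
  apply lintegral_congr_ae
  filter_upwards [fourier_toLp_ae_eq hv1 hv2] with ξ hξ
  have hF : 𝓕 (fun x ↦ u x - u (x + h)) ξ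
      = (1 - Complex.exp (↑(2 * π * ξ * h) * Complex.I)) * 𝓕 u ξ := by
    have hshift : 𝓕 (fun x ↦ u (x + h)) ξ = Complex.exp (↑(2 * π * ξ * h) * Complex.I) * 𝓕 u ξ := by
      have := congrFun (VectorFourier.fourierIntegral_comp_add_right 𝐞 (volume : Measure ℝ)
        (innerₗ ℝ) u h) ξ
      refine this.trans ?_
      rw [Circle.smul_def, Real.fourierChar_apply, smul_eq_mul]
      simp only [innerₗ_apply_apply, RCLike.inner_apply, conj_trivial, mul_assoc]
      rfl
    rw [sub_mul, one_mul, ← hshift, fourier_real_eq, fourier_real_eq, fourier_real_eq,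
      ← integral_sub]
    · simp_rw [smul_sub]
    · simpa [mul_comm] using (Real.fourierIntegral_convergent_iff (μ := volume) ξ).2 hu1
    · simpa [mul_comm] using (Real.fourierIntegral_convergent_iff (μ := volume) ξ).2 hs1
  rw [hξ, hF, enorm_mul, mul_pow]
  congr 1
  rw [← ofReal_norm, ← ENNReal.ofReal_pow (norm_nonneg _), ← Complex.normSq_eq_norm_sq,
    Complex.normSq_apply]
  congr 1
  simp only [Complex.sub_re, Complex.one_re, Complex.exp_ofReal_mul_I_re, Complex.sub_im,
    Complex.one_im, Complex.exp_ofReal_mul_I_im]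
  nlinarith [sin_sq_add_cos_sq (2 * π * ξ * h)]

/-- The Gagliardo energy as a Fourier integral. -/
theorem gagliardoEnergy_eq_lintegral_fourier {u : ℝ → ℝ} (hu1 : Integrable u)
    (hu2 : MemLp u 2 volume) :
    gagliardoEnergy u
      = ∫⁻ ξ, ENNReal.ofReal (4 * π ^ 2 * |ξ|) * ‖𝓕 (fun x ↦ (u x : ℂ)) ξ‖ₑ ^ 2 := by
  have hum : AEMeasurable u volume := hu2.1.aemeasurable
  have hu1c : Integrable fun x ↦ (u x : ℂ) := hu1.ofReal
  have hu2c : MemLp (fun x ↦ (u x : ℂ)) 2 volume := hu2.ofReal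
  have hFm : Measurable (𝓕 fun x ↦ (u x : ℂ)) :=
    (VectorFourier.fourierIntegral_continuous Real.continuous_fourierChar
      (by exact continuous_inner) hu1c).measurable
  -- The shear `(x, h) ↦ (x, x + h)` makes the kernel depend on `h` alone.
  have hshear : MeasurePreserving (fun z : ℝ × ℝ ↦ (z.1, z.1 + z.2)) (volume.prod volume)
      (volume.prod volume) := measurePreserving_prod_add volume volume
  have hfst : AEMeasurable (fun p : ℝ × ℝ ↦ u p.1) (volume.prod volume) :=
    hum.comp_quasiMeasurePreserving Measure.quasiMeasurePreserving_fst
  have hsnd : AEMeasurable (fun p : ℝ × ℝ ↦ u p.2) (volume.prod volume) :=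
    hum.comp_quasiMeasurePreserving Measure.quasiMeasurePreserving_snd
  have hadd : AEMeasurable (fun p : ℝ × ℝ ↦ u (p.1 + p.2)) (volume.prod volume) :=
    hsnd.comp_quasiMeasurePreserving hshear.quasiMeasurePreserving
  calc gagliardoEnergy u
      = ∫⁻ p : ℝ × ℝ, ENNReal.ofReal ((u p.1 - u (p.1 + p.2)) ^ 2 / p.2 ^ 2)
          ∂(volume.prod volume) := by
        rw [gagliardoEnergy, Measure.volume_eq_prod]
        have hemb : MeasurableEmbedding fun z : ℝ × ℝ ↦ (z.1, z.1 + z.2) :=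
          (MeasurableEquiv.shearAddRight ℝ).measurableEmbedding
        rw [← hshear.lintegral_comp_emb hemb]
        simp
    _ = ∫⁻ h, ∫⁻ x, ENNReal.ofReal ((u x - u (x + h)) ^ 2 / h ^ 2) := by
        rw [lintegral_prod_symm]
        fun_prop
    _ = ∫⁻ h, ∫⁻ ξ, ENNReal.ofReal ((2 - 2 * cos (2 * π * ξ * h)) / h ^ 2) *
          ‖𝓕 (fun x ↦ (u x : ℂ)) ξ‖ₑ ^ 2 := by
        refine lintegral_congr fun h ↦ ?_
        have e1 : ∀ x, ENNReal.ofReal ((u x - u (x + h)) ^ 2 / h ^ 2)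
            = ENNReal.ofReal (h ^ 2)⁻¹ * ‖(u x : ℂ) - (u (x + h) : ℂ)‖ₑ ^ 2 := fun x ↦ by
          rw [← Complex.ofReal_sub, ← ofReal_norm, Complex.norm_real, norm_eq_abs,
            ← ENNReal.ofReal_pow (abs_nonneg _), sq_abs, ← ENNReal.ofReal_mul (by positivity),
            inv_mul_eq_div]
        have e2 : ∀ ξ, ENNReal.ofReal ((2 - 2 * cos (2 * π * ξ * h)) / h ^ 2) *
            ‖𝓕 (fun x ↦ (u x : ℂ)) ξ‖ₑ ^ 2 = ENNReal.ofReal (h ^ 2)⁻¹ *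
              (ENNReal.ofReal (2 - 2 * cos (2 * π * ξ * h)) *
                ‖𝓕 (fun x ↦ (u x : ℂ)) ξ‖ₑ ^ 2) := fun ξ ↦ by
          rw [← mul_assoc, ← ENNReal.ofReal_mul (by positivity), inv_mul_eq_div]
        simp_rw [e1, e2]
        rw [lintegral_const_mul' _ _ ENNReal.ofReal_ne_top,
          lintegral_const_mul' _ _ ENNReal.ofReal_ne_top, lintegral_sub_comp_add_sq hu1c hu2c]
    _ = ∫⁻ ξ, ∫⁻ h, ENNReal.ofReal ((2 - 2 * cos (2 * π * ξ * h)) / h ^ 2) *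
          ‖𝓕 (fun x ↦ (u x : ℂ)) ξ‖ₑ ^ 2 := by
        refine lintegral_lintegral_swap (Measurable.aemeasurable ?_)
        simp only [Function.uncurry_def]
        fun_prop
    _ = _ := by
        refine lintegral_congr fun ξ ↦ ?_
        rw [lintegral_mul_const _ (by fun_prop), lintegral_two_sub_two_cos_div_sq]

/-! ### The space `X`: scaling, Poincaré inequality, fractional Laplacian -/

theorem gagliardoEnergy_const_mul (c : ℝ) (u : ℝ → ℝ) :
    gagliardoEnergy (fun x ↦ c * u x) = ENNReal.ofReal (c ^ 2) * gagliardoEnergy u := by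
  rw [gagliardoEnergy, gagliardoEnergy, ← lintegral_const_mul' _ _ ENNReal.ofReal_ne_top]
  refine lintegral_congr fun p ↦ ?_
  rw [← ENNReal.ofReal_mul (by positivity)]
  congr 1
  ring

theorem MemX.const_mul {u : ℝ → ℝ} (hu : MemX u) (c : ℝ) : MemX fun x ↦ c * u x := by
  refine ⟨⟨hu.1.1.const_mul c, ?_⟩, ?_⟩
  · rw [gagliardoEnergy_const_mul]
    exact ENNReal.mul_lt_top ENNReal.ofReal_lt_top hu.1.2
  · filter_upwards [hu.2] with x hx h
    rw [hx h, mul_zero]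

theorem MemX.integrable {u : ℝ → ℝ} (hu : MemX u) : Integrable u := by
  have h : IntegrableOn u (Ioo 0 1) := (hu.1.1.restrict (Ioo 0 1)).integrable (by norm_num)
  exact h.integrable_of_ae_notMem_eq_zero hu.2

/-- The Poincaré inequality on `X`. -/
theorem MemX.lintegral_sq_le {u : ℝ → ℝ} (hu : MemX u) :
    ∫⁻ x, ‖u x‖ₑ ^ 2 ≤ 4 * gagliardoEnergy u := by
  have hum : AEMeasurable u volume := hu.1.1.1.aemeasurable
  have hfst : AEMeasurable (fun p : ℝ × ℝ ↦ u p.1) (volume.prod volume) :=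
    hum.comp_quasiMeasurePreserving Measure.quasiMeasurePreserving_fst
  have hsnd : AEMeasurable (fun p : ℝ × ℝ ↦ u p.2) (volume.prod volume) :=
    hum.comp_quasiMeasurePreserving Measure.quasiMeasurePreserving_snd
  have hsupp : ∫⁻ x, ‖u x‖ₑ ^ 2 = ∫⁻ x in Ioo 0 1, ‖u x‖ₑ ^ 2 := by
    rw [← lintegral_indicator measurableSet_Ioo]
    apply lintegral_congr_ae
    filter_upwards [hu.2] with x hx
    by_cases h : x ∈ Ioo (0 : ℝ) 1
    · rw [indicator_of_mem h]
    · rw [indicator_of_notMem h, hx h]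
      simp
  have hinner : ∀ x ∈ Ioo (0 : ℝ) 1, ‖u x‖ₑ ^ 2 ≤
      4 * ∫⁻ y, ENNReal.ofReal ((u x - u y) ^ 2 / |x - y| ^ 2) := by
    intro x hx
    -- The window `(1, 2)` has length one and `u` vanishes almost everywhere there; since `|x - y| ≤
    -- 2`, the factor is `4`.
    calc ‖u x‖ₑ ^ 2 = ∫⁻ _ in Ioo (1 : ℝ) 2, ‖u x‖ₑ ^ 2 := by
          rw [setLIntegral_const, Real.volume_Ioo]
          norm_num
      _ ≤ ∫⁻ y in Ioo (1 : ℝ) 2, 4 * ENNReal.ofReal ((u x - u y) ^ 2 / |x - y| ^ 2) := by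
          apply lintegral_mono_ae
          filter_upwards [ae_restrict_mem measurableSet_Ioo, ae_restrict_of_ae hu.2] with y hy hy0
          rw [hy0 fun h ↦ by linarith [h.2, hy.1], sub_zero, ← ofReal_norm, norm_eq_abs,
            ← ENNReal.ofReal_pow (abs_nonneg _), sq_abs,
            show (4 : ℝ≥0∞) = ENNReal.ofReal 4 by norm_num, ← ENNReal.ofReal_mul (by norm_num)]
          apply ENNReal.ofReal_le_ofReal
          have h1 : 0 < (x - y) ^ 2 := by
            have : x - y < 0 := by linarith [hx.2, hy.1]
            exact sq_pos_of_neg this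
          have h2 : (x - y) ^ 2 ≤ 4 := by nlinarith [hx.1, hx.2, hy.1, hy.2]
          rw [sq_abs, mul_div_assoc', le_div_iff₀ h1]
          nlinarith [sq_nonneg (u x)]
      _ ≤ ∫⁻ y, 4 * ENNReal.ofReal ((u x - u y) ^ 2 / |x - y| ^ 2) :=
          setLIntegral_le_lintegral _ _
      _ = _ := lintegral_const_mul' _ _ (by norm_num)
  calc ∫⁻ x, ‖u x‖ₑ ^ 2 = ∫⁻ x in Ioo 0 1, ‖u x‖ₑ ^ 2 := hsupp
    _ ≤ ∫⁻ x in Ioo 0 1, 4 * ∫⁻ y, ENNReal.ofReal ((u x - u y) ^ 2 / |x - y| ^ 2) :=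
        setLIntegral_mono' measurableSet_Ioo hinner
    _ ≤ ∫⁻ x, 4 * ∫⁻ y, ENNReal.ofReal ((u x - u y) ^ 2 / |x - y| ^ 2) :=
        setLIntegral_le_lintegral _ _
    _ = 4 * gagliardoEnergy u := by
        rw [lintegral_const_mul' _ _ (by norm_num), gagliardoEnergy, Measure.volume_eq_prod,
          lintegral_prod _ (by fun_prop)]

/-- Take for `g` the inverse transform of the symbol times `𝓕 u`. The threshold `2π` is the ratio of
the Gagliardo weight `4π²|ξ|` to the squared symbol `2π|ξ|`. -/
theorem MemX.exists_isFractionalLaplacian {u : ℝ → ℝ} (hu : MemX u)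
    (henergy : gagliardoEnergy u ≤ ENNReal.ofReal (2 * π)) :
    ∃ g : Lp ℂ 2 (volume : Measure ℝ), IsFractionalLaplacian (1 / 4) u g ∧ ‖g‖ ≤ 1 := by
  have hu2c : MemLp (fun x ↦ (u x : ℂ)) 2 volume := hu.1.1.ofReal
  have hu1c : Integrable fun x ↦ (u x : ℂ) := hu.integrable.ofReal
  set F : Lp ℂ 2 (volume : Measure ℝ) := 𝓕 hu2c.toLp with hF
  set G : ℝ → ℂ := fun ξ ↦ (((2 * π * |ξ|) ^ (2 * (1 / 4 : ℝ)) : ℝ) : ℂ) * F ξ with hG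
  have hGm : AEStronglyMeasurable G volume := by
    refine AEStronglyMeasurable.mul (Measurable.aestronglyMeasurable ?_) (Lp.memLp F).1
    fun_prop
  have hGle : ∫⁻ ξ, ‖G ξ‖ₑ ^ 2 ≤ 1 := by
    calc ∫⁻ ξ, ‖G ξ‖ₑ ^ 2
        = ∫⁻ ξ, ENNReal.ofReal (2 * π)⁻¹ * (ENNReal.ofReal (4 * π ^ 2 * |ξ|) *
            ‖𝓕 (fun x ↦ (u x : ℂ)) ξ‖ₑ ^ 2) := by
          apply lintegral_congr_ae
          filter_upwards [fourier_toLp_ae_eq hu1c hu2c] with ξ hξ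
          rw [hG, ← mul_assoc, ← ENNReal.ofReal_mul (by positivity), ← hξ]
          simp only
          rw [enorm_mul, mul_pow]
          congr 1
          rw [← ofReal_norm, Complex.norm_real, norm_of_nonneg (by positivity),
            ← ENNReal.ofReal_pow (by positivity), ← rpow_mul_natCast (by positivity)]
          norm_num
          congr 1
          field_simp
          ring
      _ ≤ ENNReal.ofReal (2 * π)⁻¹ * ENNReal.ofReal (2 * π) := by
          rw [lintegral_const_mul' _ _ ENNReal.ofReal_ne_top,
            ← gagliardoEnergy_eq_lintegral_fourier hu.integrable hu.1.1]
          gcongr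
      _ = 1 := by
          rw [← ENNReal.ofReal_mul (by positivity), inv_mul_cancel₀ (by positivity),
            ENNReal.ofReal_one]
  have hG2 : MemLp G 2 volume := by
    refine ⟨hGm, ?_⟩
    rw [eLpNorm_lt_top_iff_lintegral_rpow_enorm_lt_top (by norm_num) (by norm_num)]
    simpa using hGle.trans_lt ENNReal.one_lt_top
  refine ⟨𝓕⁻ hG2.toLp, ⟨hu2c, ?_⟩, ?_⟩
  · rw [FourierTransform.fourier_fourierInv_eq]
    exact hG2.coeFn_toLp
  · have h1 : ‖hG2.toLp‖ₑ ^ 2 ≤ 1 := by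
      rw [enorm_sq_eq_lintegral]
      refine le_of_eq_of_le (lintegral_congr_ae ?_) hGle
      filter_upwards [hG2.coeFn_toLp] with ξ hξ
      rw [hξ]
    rw [← Lp.norm_fourier_eq, FourierTransform.fourier_fourierInv_eq]
    rw [← ofReal_norm, ← ENNReal.ofReal_pow (norm_nonneg _), ENNReal.ofReal_le_one] at h1
    exact (sq_le_one_iff₀ (norm_nonneg _)).1 h1

theorem MemX.eLpNorm_sq_le {u : ℝ → ℝ} (hu : MemX u) :
    (eLpNorm u 2 volume).toReal ^ 2 ≤ 4 * (gagliardoEnergy u).toReal := by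
  have h := hu.lintegral_sq_le
  rw [lintegral_enorm_sq_eq_ofReal hu.1.1, ← ENNReal.ofReal_toReal hu.1.2.ne,
    show (4 : ℝ≥0∞) = ENNReal.ofReal 4 by norm_num, ← ENNReal.ofReal_mul (by norm_num)] at h
  exact (ENNReal.ofReal_le_ofReal_iff (by positivity)).1 h

/-! ### Transfer from the line to `X` -/

theorem exists_bound_of_mem_ozawaConstants {ω : ℝ} (hω : ω ∈ ozawaConstants) {α : ℝ}
    (hα : 0 < α) (hα' : α < 2 * π * ω) : ∃ K : ℝ, 0 < K ∧
      ∀ u : ℝ → ℝ, MemX u → gagliardoSeminorm u ≤ 1 →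
        IntegrableOn (fun x => Real.exp (α * u x ^ 2)) (Ioo (0 : ℝ) 1) ∧
        ∫ x in (0 : ℝ)..1, Real.exp (α * u x ^ 2) ≤ K := by
  obtain ⟨H, hH, hbound⟩ := hω.2.2 (α / (2 * π)) (by positivity)
    (by rwa [div_lt_iff₀' (by positivity)])
  -- For `√(2π) u` the energy is at most `2π`, so the Poincaré constant `4` gives `8π`; the `1`
  -- restores the term subtracted from the exponential on the unit interval.
  refine ⟨H * (8 * π) + 1, by positivity, fun u hu hu1 ↦ ?_⟩
  have hv : MemX fun x ↦ √(2 * π) * u x := hu.const_mul _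
  have hE1 : (gagliardoEnergy u).toReal ≤ 1 := by
    rw [gagliardoSeminorm, sqrt_le_one] at hu1
    exact hu1
  have hEv : gagliardoEnergy (fun x ↦ √(2 * π) * u x) ≤ ENNReal.ofReal (2 * π) := by
    rw [gagliardoEnergy_const_mul, sq_sqrt (by positivity)]
    refine mul_le_of_le_one_right zero_le ?_
    rw [← ENNReal.ofReal_toReal hu.1.2.ne]
    exact ENNReal.ofReal_le_one.2 hE1
  obtain ⟨g, hg, hg1⟩ := hv.exists_isFractionalLaplacian hEv
  obtain ⟨hint, hle⟩ := hbound _ hv.1 g hg hg1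
  have e : ∀ x, α / (2 * π) * (√(2 * π) * u x) ^ 2 = α * u x ^ 2 := fun x ↦ by
    rw [mul_pow, sq_sqrt (by positivity)]
    field_simp
  simp_rw [e] at hint hle
  have hnorm : (eLpNorm (fun x ↦ √(2 * π) * u x) 2 volume).toReal ^ 2 ≤ 8 * π := by
    have h1 := ENNReal.toReal_le_of_le_ofReal (by positivity) hEv
    linarith [hv.eLpNorm_sq_le]
  have hon : IntegrableOn (fun x ↦ exp (α * u x ^ 2)) (Ioc (0 : ℝ) 1) := by
    have h1 : IntegrableOn (fun _ ↦ (1 : ℝ)) (Ioc (0 : ℝ) 1) :=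
      integrableOn_const (by simp)
    refine (hint.integrableOn.add h1).congr (ae_of_all _ fun x ↦ ?_)
    simp
  refine ⟨hon.mono_set Ioo_subset_Ioc_self, ?_⟩
  have hsplit : ∫ x in (0 : ℝ)..1, exp (α * u x ^ 2)
      = (∫ x in Ioc (0 : ℝ) 1, (exp (α * u x ^ 2) - 1)) + 1 := by
    rw [intervalIntegral.integral_of_le zero_le_one, integral_sub hon (integrableOn_const (by simp))]
    simp
  have hset : ∫ x in Ioc (0 : ℝ) 1, (exp (α * u x ^ 2) - 1) ≤ ∫ x, (exp (α * u x ^ 2) - 1) :=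
    setIntegral_le_integral hint (ae_of_all _ fun x ↦ sub_nonneg.2 (one_le_exp (by positivity)))
  rw [hsplit]
  gcongr
  exact (hset.trans hle).trans (by gcongr)

theorem corollary2p4 :
    ∃ ω : ℝ, 0 < ω ∧ ω ≤ π ∧ IsGreatest ozawaConstants ω ∧
      ∀ α : ℝ, 0 < α → α < 2 * π * ω → ∃ K : ℝ, 0 < K ∧
        ∀ u : ℝ → ℝ, MemX u → gagliardoSeminorm u ≤ 1 →
          IntegrableOn (fun x => Real.exp (α * u x ^ 2)) (Ioo (0 : ℝ) 1) ∧
          ∫ x in (0 : ℝ)..1, Real.exp (α * u x ^ 2) ≤ K := by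
  obtain ⟨ω, hω⟩ := exists_isGreatest_ozawaConstants
  exact ⟨ω, hω.1.1, hω.1.2.1, hω, fun _ hα hα' ↦ exists_bound_of_mem_ozawaConstants hω.1 hα hα'⟩
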